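/- Second-order Henkin logic (HPL) uses formulas built from individual variables and, for each $n\ge 1$, $n$-ary predicate variables, from atomic formulas $A x_{1}\cdots x_{n}$, $x=y$ and $A=B$ ($A,B$ of the same arity), by the propositional connectives and by quantifiers over individual and over predicate variables (a variable may be quantified only if all its occurrences in the formula are free). A predicate structure $\Sigma=(J_n)_{n\ge 0}$ consists of a non-empty set $J_0$ of individuals and, for each $n\ge 1$, a non-empty set $J_n$ of $n$-ary predicates on $J_0$; individual variables range over $J_0$ and $n$-ary predicate variables over $J_n$. It is a model of a formula if the formula is true in it under every assignment, and a model of a set of formulas if it is a model of each member. A Henkin structure is a predicate structure that is a model of all comprehension axioms $\exists A\,\forall x_1\cdots\forall x_n\,(A x_1\cdots x_n\leftrightarrow H)$, where $n\geq 1$, $H$ is a formula, the distinct variables $x_1,\dots,x_n$ occur only free in $H$ (if at all), and the $n$-ary predicate variable $A$ does not occur in $H$. A set $G$ of formulas HPL-entails a set $K$ of formulas if every Henkin structure that is a model of $G$ is a model of $K$. The set $K$ is HPL-independent of $G$ if there are a Henkin structure that is a model of $G$ and of $K$, and a Henkin structure that is a model of $G$ but not of $K$. Let $AC^{1,1}$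 be the sentence \[\forall A\,\forall R\,\exists S\,\bigl(\forall x\,(Ax\leftrightarrow\exists y\,Rxy)\to\forall x\,(Ax\to\exists!!\,y\,(Rxy\land Sxy))\bigr),\] with $A$ unary and $R,S$ binary, where $\exists!!\,y\,G(y)$ abbreviates $\exists y\,G(y)\land\forall y_1\forall y_2\,(G(y_1)\land G(y_2)\to y_1=y_2)$. Let $choice_h^{1,1}$ be the set of all formulas \[\forall x\,\exists D\,H(x,D)\to\exists S\,\forall x\,\exists D\,\bigl(\forall y\,(Dy\leftrightarrow Sxy)\land H(x,D)\bigr),\] where $D$ is a unary predicate variable, $H$ is a formula in which $x$ and $D$ occur only free (if at all) and which may have further free variables, $y$ is an individual variable different from $x$ that does not occur in $H$, and $S$ is a binary predicate variable that does not occur in $H$. Theorem. The Ackermann axiom scheme $choice_h^{1,1}$ is HPL-independent of $AC^{1,1}$. In particular, $AC^{1,1}$ does not HPL-entail $choice_h^{1,1}$. -/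

import Mathlib

universe u

namespace HPL

/-- Second-order formulas with named variables. Individual variables `x_i` are given by their index
`i : ℕ`; predicate variables have arity at least one, and `A_i^(k+1)` is given by the pair `k i : ℕ`
(so that `k` is the arity minus one). -/
inductive Formula : Type
  /-- the atomic formula `A_i^(k+1) x_(v 0) ... x_(v k)` -/
  | app (k i : ℕ) (v : Fin (k + 1) → ℕ) : Formula
  /-- `x_i = x_j` -/
  | eqInd (i j : ℕ) : Formula
  /-- `A_i^(k+1) = A_j^(k+1)` -/
  | eqPred (k i j : ℕ) : Formula
  | not (H : Formula) : Formula
  | and (H₁ H₂ : Formula) : Formula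
  | or (H₁ H₂ : Formula) : Formula
  | imp (H₁ H₂ : Formula) : Formula
  | iff (H₁ H₂ : Formula) : Formula
  /-- `∀ x_i H` -/
  | allInd (i : ℕ) (H : Formula) : Formula
  /-- `∃ x_i H` -/
  | exInd (i : ℕ) (H : Formula) : Formula
  /-- `∀ A_i^(k+1) H` -/
  | allPred (k i : ℕ) (H : Formula) : Formula
  /-- `∃ A_i^(k+1) H` -/
  | exPred (k i : ℕ) (H : Formula) : Formula

namespace Formula

/-- `x_j` has a bound occurrence in the formula, that is, the formula contains a quantifier
`∀ x_j` or `∃ x_j`. -/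
def BoundInd (j : ℕ) : Formula → Prop
  | app _ _ _ => False
  | eqInd _ _ => False
  | eqPred _ _ _ => False
  | not H => BoundInd j H
  | and H₁ H₂ => BoundInd j H₁ ∨ BoundInd j H₂
  | or H₁ H₂ => BoundInd j H₁ ∨ BoundInd j H₂
  | imp H₁ H₂ => BoundInd j H₁ ∨ BoundInd j H₂
  | iff H₁ H₂ => BoundInd j H₁ ∨ BoundInd j H₂
  | allInd i H => j = i ∨ BoundInd j H
  | exInd i H => j = i ∨ BoundInd j H
  | allPred _ _ H => BoundInd j H
  | exPred _ _ H => BoundInd j H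

/-- `A_j^(l+1)` has a bound occurrence in the formula. -/
def BoundPred (l j : ℕ) : Formula → Prop
  | app _ _ _ => False
  | eqInd _ _ => False
  | eqPred _ _ _ => False
  | not H => BoundPred l j H
  | and H₁ H₂ => BoundPred l j H₁ ∨ BoundPred l j H₂
  | or H₁ H₂ => BoundPred l j H₁ ∨ BoundPred l j H₂
  | imp H₁ H₂ => BoundPred l j H₁ ∨ BoundPred l j H₂
  | iff H₁ H₂ => BoundPred l j H₁ ∨ BoundPred l j H₂
  | allInd _ H => BoundPred l j H
  | exInd _ H => BoundPred l j H
  | allPred k i H => (l = k ∧ j = i) ∨ BoundPred l j H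
  | exPred k i H => (l = k ∧ j = i) ∨ BoundPred l j H

/-- `x_j` occurs (free or bound) in the formula. -/
def OccursInd (j : ℕ) : Formula → Prop
  | app _ _ v => ∃ t, j = v t
  | eqInd i i' => j = i ∨ j = i'
  | eqPred _ _ _ => False
  | not H => OccursInd j H
  | and H₁ H₂ => OccursInd j H₁ ∨ OccursInd j H₂
  | or H₁ H₂ => OccursInd j H₁ ∨ OccursInd j H₂
  | imp H₁ H₂ => OccursInd j H₁ ∨ OccursInd j H₂
  | iff H₁ H₂ => OccursInd j H₁ ∨ OccursInd j H₂
  | allInd i H => j = i ∨ OccursInd j H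
  | exInd i H => j = i ∨ OccursInd j H
  | allPred _ _ H => OccursInd j H
  | exPred _ _ H => OccursInd j H

/-- `A_j^(l+1)` occurs (free or bound) in the formula. -/
def OccursPred (l j : ℕ) : Formula → Prop
  | app k i _ => l = k ∧ j = i
  | eqInd _ _ => False
  | eqPred k i i' => l = k ∧ (j = i ∨ j = i')
  | not H => OccursPred l j H
  | and H₁ H₂ => OccursPred l j H₁ ∨ OccursPred l j H₂
  | or H₁ H₂ => OccursPred l j H₁ ∨ OccursPred l j H₂
  | imp H₁ H₂ => OccursPred l j H₁ ∨ OccursPred l j H₂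
  | iff H₁ H₂ => OccursPred l j H₁ ∨ OccursPred l j H₂
  | allInd _ H => OccursPred l j H
  | exInd _ H => OccursPred l j H
  | allPred k i H => (l = k ∧ j = i) ∨ OccursPred l j H
  | exPred k i H => (l = k ∧ j = i) ∨ OccursPred l j H

/-- The formation rule: a variable may be quantified in `H` only if all its occurrences in `H`
are free. -/
def WellFormed : Formula → Prop
  | app _ _ _ => True
  | eqInd _ _ => True
  | eqPred _ _ _ => True
  | not H => WellFormed H
  | and H₁ H₂ => WellFormed H₁ ∧ WellFormed H₂
  | or H₁ H₂ => WellFormed H₁ ∧ WellFormed H₂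
  | imp H₁ H₂ => WellFormed H₁ ∧ WellFormed H₂
  | iff H₁ H₂ => WellFormed H₁ ∧ WellFormed H₂
  | allInd i H => WellFormed H ∧ ¬ BoundInd i H
  | exInd i H => WellFormed H ∧ ¬ BoundInd i H
  | allPred k i H => WellFormed H ∧ ¬ BoundPred k i H
  | exPred k i H => WellFormed H ∧ ¬ BoundPred k i H

/-- `∀ x_(i₁) ... ∀ x_(iₙ) H` for a list `i₁, ..., iₙ` of indices. -/
def allInds (l : List ℕ) (H : Formula) : Formula :=
  l.foldr allInd H

end Formula

open Formula in
/-- The language of second-order logic: the set of all (well-formed) formulas. -/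
def L2 : Set Formula :=
  {H | WellFormed H}

/-- A predicate structure `(J_n)_(n ≥ 0)`: a non-empty domain `Ind = J_0` of individuals and, for
every arity `k + 1 ≥ 1`, a non-empty set `J k` of `(k+1)`-ary predicates on `Ind`. -/
structure PredStructure : Type (u + 1) where
  /-- the individuals -/
  Ind : Type u
  ind_nonempty : Nonempty Ind
  /-- the domain of the `(k+1)`-ary predicates -/
  J : (k : ℕ) → Set ((Fin (k + 1) → Ind) → Prop)
  J_nonempty : ∀ k, (J k).Nonempty

/-- An assignment in `M`: individuals for the individual variables, and predicates belonging to
`M` for the predicate variables, of matching arity. -/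
structure Assignment (M : PredStructure.{u}) : Type u where
  /-- the value of `x_i` -/
  ind : ℕ → M.Ind
  /-- the value of `A_i^(k+1)` -/
  pred : (k : ℕ) → ℕ → M.J k

namespace Assignment

variable {M : PredStructure.{u}}

/-- The assignment like `f`, except that it assigns `ξ` to `x_i`. -/
def setInd (f : Assignment M) (i : ℕ) (ξ : M.Ind) : Assignment M where
  ind := Function.update f.ind i ξ
  pred := f.pred

/-- The assignment like `f`, except that it assigns `α` to `A_i^(k+1)`. -/
def setPred (f : Assignment M) (k i : ℕ) (α : M.J k) : Assignment M where
  ind := f.ind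
  pred := Function.update f.pred k (Function.update (f.pred k) i α)

end Assignment

namespace PredStructure

open Formula

/-- The formula is true in `M` under the assignment `f`. -/
def Eval (M : PredStructure.{u}) : Formula → Assignment M → Prop
  | app k i v, f => (f.pred k i).1 (fun t => f.ind (v t))
  | eqInd i j, f => f.ind i = f.ind j
  | eqPred k i j, f => f.pred k i = f.pred k j
  | Formula.not H, f => ¬ M.Eval H f
  | Formula.and H₁ H₂, f => M.Eval H₁ f ∧ M.Eval H₂ f
  | Formula.or H₁ H₂, f => M.Eval H₁ f ∨ M.Eval H₂ f
  | imp H₁ H₂, f => M.Eval H₁ f → M.Eval H₂ f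
  | Formula.iff H₁ H₂, f => (M.Eval H₁ f ↔ M.Eval H₂ f)
  | allInd i H, f => ∀ ξ : M.Ind, M.Eval H (f.setInd i ξ)
  | exInd i H, f => ∃ ξ : M.Ind, M.Eval H (f.setInd i ξ)
  | allPred k i H, f => ∀ α : M.J k, M.Eval H (f.setPred k i α)
  | exPred k i H, f => ∃ α : M.J k, M.Eval H (f.setPred k i α)

/-- `M` is a model of every formula in `G`: every formula in `G` is true in `M` under every
assignment. -/
def Models (M : PredStructure.{u}) (G : Set Formula) : Prop :=
  ∀ F ∈ G, ∀ f : Assignment M, M.Eval F f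

end PredStructure

open Formula in
/-- The axioms of comprehension `∃ A ∀ x₁ ... ∀ xₙ (A x₁ ... xₙ ↔ H)`, for all `n ≥ 1`, all pairwise
distinct individual variables `x₁, ..., xₙ` that occur only free in `H` (if at all), and all
`n`-ary predicate variables `A` that do not occur in `H`. -/
def comprehension : Set Formula :=
  {F | ∃ (k i : ℕ) (v : Fin (k + 1) → ℕ) (H : Formula),
    H ∈ L2 ∧ Function.Injective v ∧ (∀ t, ¬ BoundInd (v t) H) ∧ ¬ OccursPred k i H ∧
    F = exPred k i (allInds (List.ofFn v) (Formula.iff (app k i v) H))}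

/-- Henkin structures (of second order): the predicate structures satisfying comprehension. -/
def PredStructure.IsHenkin (M : PredStructure.{u}) : Prop :=
  M.Models comprehension

/-- `G` HPL-entails every formula in `K`: every Henkin structure that is a model of `G` is a model
of `K`. -/
def Entails (G K : Set Formula) : Prop :=
  ∀ M : PredStructure.{u}, M.IsHenkin → M.Models G → M.Models K

/-- The axiom scheme `K` is HPL-independent of `G`: some Henkin model of `G` is a model of all
axioms in `K`, and some Henkin model of `G` is not. -/
def Independent (K G : Set Formula) : Prop :=
  (∃ M : PredStructure.{u}, M.IsHenkin ∧ M.Models G ∧ M.Models K) ∧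
  (∃ M : PredStructure.{u}, M.IsHenkin ∧ M.Models G ∧ ¬ M.Models K)

open Formula in
/-- `AC^(1,1)`, the sentence
`∀ A ∀ R ∃ S (∀ x (A x ↔ ∃ y R x y) → ∀ x (A x → ∃!! y (R x y ∧ S x y)))`, where `∃!! y G(y)` stands
for `∃ y G(y) ∧ ∀ y₁ ∀ y₂ (G(y₁) ∧ G(y₂) → y₁ = y₂)`.
Here `x, y, y₁, y₂` are `x_0, x_1, x_2, x_3`, and `A, R, S` are `A_0^1, A_0^2, A_1^2`. -/
def AC11 : Formula :=
  allPred 0 0 <| allPred 1 0 <| exPred 1 1 <|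
    imp
      (allInd 0 (Formula.iff (app 0 0 ![0]) (exInd 1 (app 1 0 ![0, 1]))))
      (allInd 0 (imp (app 0 0 ![0])
        (Formula.and
          (exInd 1 (Formula.and (app 1 0 ![0, 1]) (app 1 1 ![0, 1])))
          (allInd 2 (allInd 3 (imp
            (Formula.and
              (Formula.and (app 1 0 ![0, 2]) (app 1 1 ![0, 2]))
              (Formula.and (app 1 0 ![0, 3]) (app 1 1 ![0, 3])))
            (eqInd 2 3)))))))

open Formula in
/-- The formula
`∀ x ∃ D H(x, D) → ∃ S ∀ x ∃ D (∀ y (D y ↔ S x y) ∧ H(x, D))`,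
where `x, y` are the individual variables with indices `x, y`, where `D` is the unary predicate
variable with index `d`, and `S` the binary predicate variable with index `s`. -/
def choiceFormula (x y d s : ℕ) (H : Formula) : Formula :=
  imp (allInd x (exPred 0 d H))
    (exPred 1 s (allInd x (exPred 0 d
      (Formula.and
        (allInd y (Formula.iff (app 0 d ![y]) (app 1 s ![x, y])))
        H))))

open Formula in
/-- The Ackermann axiom scheme `choice_h^(1,1)`: all formulas
`∀ x ∃ D H(x, D) → ∃ S ∀ x ∃ D (∀ y (D y ↔ S x y) ∧ H(x, D))`, where `H` is a formula in which `x`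
and `D` occur only free (if at all); `y` (different from `x`) and `S` are new variables. The
formula `H` may have further free variables. -/
def choiceH11 : Set Formula :=
  {F | ∃ (x y d s : ℕ) (H : Formula),
    H ∈ L2 ∧ ¬ BoundInd x H ∧ ¬ BoundPred 0 d H ∧
    y ≠ x ∧ ¬ OccursInd y H ∧ ¬ OccursPred 1 s H ∧
    F = choiceFormula x y d s H}

end HPL

namespace HPL

open Formula

/-! ### Finiteness of the set of variables of a formula -/

namespace Formula

/-! A full structure satisfies both principles, by choice in the metatheory. The separating
structure is a permutation model: individuals `ℕ × A` with `A` infinite, permutations of `A` acting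
on the second coordinate, and exactly the predicates invariant under the pointwise stabilizer of
some finite `E ⊆ A`. Comprehension holds because truth is invariant under automorphisms
(`eval_mapAssignment`) and a formula has only finitely many parameters, whose supports unite to a
finite one.

`AC11` survives: up to permutations fixing `x` and the support of `R`, a witness `y` lies in the
column of `x` or in one of finitely many fixed columns, so it can be named by an invariant code and
codes can be chosen invariantly. The Ackermann scheme fails for "`D` is an injective partial
function from `ℕ` to `A` defined below the first coordinate of `x`". Each `x` admits a finite such
`D`, but one finitely supported `S` would bound the size of all of them. -/

theorem finite_occursInd (H : Formula) : {i | OccursInd i H}.Finite := by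
  induction H with
  | app k i v => exact (Set.finite_range v).subset fun j ⟨t, ht⟩ => ⟨t, ht.symm⟩
  | eqInd i j => exact (Set.toFinite {i, j}).subset fun l hl => hl
  | eqPred => exact Set.finite_empty
  | not H ih => exact ih
  | and H₁ H₂ ih₁ ih₂ => exact ih₁.union ih₂
  | or H₁ H₂ ih₁ ih₂ => exact ih₁.union ih₂
  | imp H₁ H₂ ih₁ ih₂ => exact ih₁.union ih₂
  | iff H₁ H₂ ih₁ ih₂ => exact ih₁.union ih₂
  | allInd i H ih => exact ih.insert i
  | exInd i H ih => exact ih.insert i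
  | allPred k i H ih => exact ih
  | exPred k i H ih => exact ih

theorem finite_occursPred (H : Formula) : {p : ℕ × ℕ | OccursPred p.1 p.2 H}.Finite := by
  have single (k i : ℕ) : {p : ℕ × ℕ | p.1 = k ∧ p.2 = i}.Finite :=
    (Set.finite_singleton (k, i)).subset fun _ hp => Prod.ext hp.1 hp.2
  induction H with
  | app k i v => exact single k i
  | eqInd i j => exact Set.finite_empty
  | eqPred k i j =>
    exact ((single k i).union (single k j)).subset fun p hp =>
      hp.2.imp (fun h => ⟨hp.1, h⟩) (fun h => ⟨hp.1, h⟩)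
  | not H ih => exact ih
  | and H₁ H₂ ih₁ ih₂ => exact ih₁.union ih₂
  | or H₁ H₂ ih₁ ih₂ => exact ih₁.union ih₂
  | imp H₁ H₂ ih₁ ih₂ => exact ih₁.union ih₂
  | iff H₁ H₂ ih₁ ih₂ => exact ih₁.union ih₂
  | allInd i H ih => exact ih
  | exInd i H ih => exact ih
  | allPred k i H ih => exact (single k i).union ih
  | exPred k i H ih => exact (single k i).union ih

end Formula

/-! ### Assignments and coincidence -/

namespace Assignment

variable {M : PredStructure.{u}}

theorem setPred_pred (f : Assignment M) (k i : ℕ) (α : M.J k) :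
    (f.setPred k i α).pred k i = α := by
  simp [setPred]

theorem setPred_pred_of_ne (f : Assignment M) {k i l j : ℕ} (α : M.J k) (h : ¬ (l = k ∧ j = i)) :
    (f.setPred k i α).pred l j = f.pred l j := by
  by_cases hl : l = k
  · subst hl
    simp [setPred, Function.update_of_ne (fun hj => h ⟨rfl, hj⟩)]
  · simp [setPred, Function.update_of_ne hl]

theorem setInd_ind (f : Assignment M) (i : ℕ) (ξ : M.Ind) : (f.setInd i ξ).ind i = ξ := by
  simp [setInd]

theorem setInd_ind_of_ne (f : Assignment M) {i j : ℕ} (ξ : M.Ind) (h : j ≠ i) :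
    (f.setInd i ξ).ind j = f.ind j := by
  simp [setInd, h]

/-- Two assignments agree on all variables that occur in `H`. -/
def AgreeOn (H : Formula) (f g : Assignment M) : Prop :=
  (∀ i, OccursInd i H → f.ind i = g.ind i) ∧ ∀ k i, OccursPred k i H → f.pred k i = g.pred k i

theorem agreeOn_setInd {H : Formula} {f g : Assignment M} {i : ℕ}
    (hi : ∀ j, j = i ∨ OccursInd j H → f.ind j = g.ind j)
    (hp : ∀ k j, OccursPred k j H → f.pred k j = g.pred k j) (ξ : M.Ind) :
    AgreeOn H (f.setInd i ξ) (g.setInd i ξ) := by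
  refine ⟨fun j hj => ?_, hp⟩
  by_cases h : j = i
  · subst h; simp only [setInd_ind]
  · simp only [setInd_ind_of_ne _ _ h, hi j (.inr hj)]

theorem agreeOn_setPred {H : Formula} {f g : Assignment M} {k i : ℕ}
    (hi : ∀ j, OccursInd j H → f.ind j = g.ind j)
    (hp : ∀ l j, (l = k ∧ j = i) ∨ OccursPred l j H → f.pred l j = g.pred l j) (α : M.J k) :
    AgreeOn H (f.setPred k i α) (g.setPred k i α) := by
  refine ⟨hi, fun l j hj => ?_⟩
  by_cases h : l = k ∧ j = i
  · obtain ⟨rfl, rfl⟩ := h; simp only [setPred_pred]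
  · simp only [setPred_pred_of_ne _ _ h, hp l j (.inr hj)]

end Assignment

namespace PredStructure

open Assignment

/-- Coincidence lemma. -/
theorem eval_congr {M : PredStructure.{u}} (H : Formula) {f g : Assignment M}
    (h : AgreeOn H f g) : M.Eval H f ↔ M.Eval H g := by
  induction H generalizing f g with
  | app k i v =>
    have hv : (fun t => f.ind (v t)) = fun t => g.ind (v t) :=
      funext fun t => h.1 _ ⟨t, rfl⟩
    simp only [Eval, h.2 k i ⟨rfl, rfl⟩, hv]
  | eqInd i j => simp only [Eval, h.1 i (.inl rfl), h.1 j (.inr rfl)]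
  | eqPred k i j => simp only [Eval, h.2 k i ⟨rfl, .inl rfl⟩, h.2 k j ⟨rfl, .inr rfl⟩]
  | not H ih => exact not_congr (ih h)
  | and H₁ H₂ ih₁ ih₂ =>
    exact and_congr (ih₁ ⟨fun i hi => h.1 i (.inl hi), fun k i hi => h.2 k i (.inl hi)⟩)
      (ih₂ ⟨fun i hi => h.1 i (.inr hi), fun k i hi => h.2 k i (.inr hi)⟩)
  | or H₁ H₂ ih₁ ih₂ =>
    exact or_congr (ih₁ ⟨fun i hi => h.1 i (.inl hi), fun k i hi => h.2 k i (.inl hi)⟩)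
      (ih₂ ⟨fun i hi => h.1 i (.inr hi), fun k i hi => h.2 k i (.inr hi)⟩)
  | imp H₁ H₂ ih₁ ih₂ =>
    exact imp_congr (ih₁ ⟨fun i hi => h.1 i (.inl hi), fun k i hi => h.2 k i (.inl hi)⟩)
      (ih₂ ⟨fun i hi => h.1 i (.inr hi), fun k i hi => h.2 k i (.inr hi)⟩)
  | iff H₁ H₂ ih₁ ih₂ =>
    exact iff_congr (ih₁ ⟨fun i hi => h.1 i (.inl hi), fun k i hi => h.2 k i (.inl hi)⟩)
      (ih₂ ⟨fun i hi => h.1 i (.inr hi), fun k i hi => h.2 k i (.inr hi)⟩)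
  | allInd i H ih => exact forall_congr' fun ξ => ih (agreeOn_setInd h.1 h.2 ξ)
  | exInd i H ih => exact exists_congr fun ξ => ih (agreeOn_setInd h.1 h.2 ξ)
  | allPred k i H ih => exact forall_congr' fun α => ih (agreeOn_setPred (H := H) h.1 h.2 α)
  | exPred k i H ih => exact exists_congr fun α => ih (agreeOn_setPred (H := H) h.1 h.2 α)

theorem comp_vec_two {α β : Type*} (g : α → β) (v : Fin 2 → α) :
    (fun t => g (v t)) = ![g (v 0), g (v 1)] :=
  funext (Fin.forall_fin_two.2 ⟨rfl, rfl⟩)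

theorem eval_allInds {M : PredStructure.{u}} (F : Formula) (l : List ℕ) (f : Assignment M)
    (h : ∀ g : Assignment M, g.pred = f.pred → (∀ i ∉ l, g.ind i = f.ind i) → M.Eval F g) :
    M.Eval (allInds l F) f := by
  induction l generalizing f with
  | nil => exact h f rfl fun _ _ => rfl
  | cons j l ih =>
    refine fun ξ => ih (f.setInd j ξ) fun g hp hg => h g hp fun i hi => ?_
    rw [List.mem_cons, not_or] at hi
    rw [hg i hi.2, setInd_ind_of_ne _ _ hi.1]

/-- A predicate structure that contains all its definable predicates is a Henkin structure. -/
theorem isHenkin_of_definable {M : PredStructure.{u}}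
    (h : ∀ (H : Formula) (f : Assignment M) (k : ℕ) (v : Fin (k + 1) → ℕ), Function.Injective v →
      (fun w => M.Eval H ⟨Function.extend v w f.ind, f.pred⟩) ∈ M.J k) :
    M.IsHenkin := by
  rintro _ ⟨k, i, v, H, -, hv, -, hA, rfl⟩ f
  refine ⟨⟨_, h H f k v hv⟩, eval_allInds _ _ _ fun g hp hg => ?_⟩
  simp only [Eval, hp, setPred_pred]
  -- The quantified variables take the values of `g` and all others those of `f`; `A` may differ
  -- since it does not occur in `H`.
  refine eval_congr H ⟨fun j _ => ?_, fun l j hj => ?_⟩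
  · by_cases hj : ∃ t, v t = j
    · obtain ⟨t, rfl⟩ := hj
      exact hv.extend_apply (fun t => g.ind (v t)) f.ind t
    · rw [hg j (by rwa [List.mem_ofFn])]
      exact Function.extend_apply' (fun t => g.ind (v t)) f.ind j hj
  · rw [hp, setPred_pred_of_ne]
    rintro ⟨rfl, rfl⟩
    exact hA hj

/-- `AC^(1,1)` says that every binary predicate contains the graph of a choice function on its
domain. -/
theorem eval_AC11_of_uniformization {M : PredStructure.{u}}
    (h : ∀ R ∈ M.J 1, ∃ S ∈ M.J 1, ∀ x, (∃ y, R ![x, y]) →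
      (∃ y, R ![x, y] ∧ S ![x, y]) ∧ ∀ y z, S ![x, y] → S ![x, z] → y = z)
    (f : Assignment M) : M.Eval AC11 f := by
  intro A R
  obtain ⟨S, hS, hRS⟩ := h R.1 R.2
  refine ⟨⟨S, hS⟩, ?_⟩
  simp only [Eval, setInd, setPred, comp_vec_two]
  simp only [Function.update_self, Function.update_of_ne, ne_eq, Nat.reduceEqDiff, not_false_eq_true,
    Matrix.cons_val_zero, Matrix.cons_val_one, Matrix.cons_val_fin_one, zero_ne_one, one_ne_zero,
    OfNat.zero_ne_ofNat]
  intro hA x hx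
  obtain ⟨h₁, h₂⟩ := hRS x ((hA x).1 hx)
  exact ⟨h₁, fun y z hyz => h₂ y z hyz.1.2 hyz.2.2⟩

/-! ### Full structures -/

/-- The structure of all individuals in `α` and all predicates on `α`. -/
abbrev full (α : Type u) [Nonempty α] : PredStructure.{u} where
  Ind := α
  ind_nonempty := inferInstance
  J _ := Set.univ
  J_nonempty _ := Set.univ_nonempty

section full

variable (α : Type u) [Nonempty α]

theorem full_isHenkin : (full α).IsHenkin :=
  isHenkin_of_definable fun _ _ _ _ _ => trivial

theorem full_models_AC11 : (full α).Models {AC11} := by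
  rintro _ rfl
  refine eval_AC11_of_uniformization fun R _ => ?_
  classical
  refine ⟨fun w => ∃ h : ∃ y, R ![w 0, y], w 1 = h.choose, trivial, fun x hx => ⟨?_, ?_⟩⟩
  · exact ⟨hx.choose, hx.choose_spec, hx, rfl⟩
  · rintro y z ⟨_, hy⟩ ⟨_, hz⟩
    exact hy.trans hz.symm

/-- The metatheory chooses a `D ξ` for each `ξ`, and `S` is the predicate with these as sections.
Freshness of `S` keeps `H` unaffected. -/
theorem full_models_choiceH11 : (full α).Models choiceH11 := by
  rintro _ ⟨x, y, d, s, H, -, -, -, hyx, hy, hs, rfl⟩ f hD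
  choose D hD using hD
  refine ⟨⟨fun w => (D (w 0)).1 fun _ => w 1, trivial⟩, fun ξ => ⟨D ξ, fun η => ?_, ?_⟩⟩
  · have hv (w : Fin 1 → α) : w = fun _ => w 0 := by ext t; fin_cases t; rfl
    simp only [Eval, setInd, setPred]
    simp [Function.update_of_ne hyx.symm]
  · refine (eval_congr H (agreeOn_setPred (f := f.setInd x ξ)
      (g := (f.setPred 1 s _).setInd x ξ) (fun _ _ => rfl) ?_ _)).1 (hD ξ)
    intro l j hj
    refine (setPred_pred_of_ne f _ ?_).symm
    rintro ⟨rfl, rfl⟩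
    exact hj.elim (fun hj => one_ne_zero hj.1) hs

end full

/-! ### Automorphisms -/

/-- The image of a predicate under a permutation of the individuals. -/
def mapPred {α : Type u} {k : ℕ} (e : Equiv.Perm α) (P : (Fin (k + 1) → α) → Prop) :
    (Fin (k + 1) → α) → Prop :=
  fun w => P fun t => e.symm (w t)

/-- A permutation of the individuals that maps the domains of predicates into themselves, as does
its inverse. -/
structure IsAutomorphism (M : PredStructure.{u}) (e : Equiv.Perm M.Ind) : Prop where
  map_mem : ∀ {k} {P}, P ∈ M.J k → mapPred e P ∈ M.J k
  map_symm_mem : ∀ {k} {P}, P ∈ M.J k → mapPred e.symm P ∈ M.J k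

namespace IsAutomorphism

variable {M : PredStructure.{u}} {e : Equiv.Perm M.Ind}

/-- The permutation of the predicates induced by an automorphism. -/
def predEquiv (he : M.IsAutomorphism e) (k : ℕ) : M.J k ≃ M.J k where
  toFun P := ⟨mapPred e P.1, he.map_mem P.2⟩
  invFun P := ⟨mapPred e.symm P.1, he.map_symm_mem P.2⟩
  left_inv P := Subtype.ext (funext fun w => by simp [mapPred])
  right_inv P := Subtype.ext (funext fun w => by simp [mapPred])

/-- The image of an assignment under an automorphism. -/
def mapAssignment (he : M.IsAutomorphism e) (f : Assignment M) : Assignment M where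
  ind i := e (f.ind i)
  pred k i := he.predEquiv k (f.pred k i)

theorem mapAssignment_setInd (he : M.IsAutomorphism e) (f : Assignment M) (i : ℕ) (ξ : M.Ind) :
    he.mapAssignment (f.setInd i ξ) = (he.mapAssignment f).setInd i (e ξ) := by
  simp only [mapAssignment, setInd, Assignment.mk.injEq, and_true]
  ext j
  exact Function.apply_update (fun _ => e) _ _ _ _

theorem mapAssignment_setPred (he : M.IsAutomorphism e) (f : Assignment M) (k i : ℕ) (α : M.J k) :
    he.mapAssignment (f.setPred k i α) = (he.mapAssignment f).setPred k i (he.predEquiv k α) := by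
  have hp (l j) : (he.mapAssignment (f.setPred k i α)).pred l j =
      ((he.mapAssignment f).setPred k i (he.predEquiv k α)).pred l j := by
    by_cases h : l = k ∧ j = i
    · obtain ⟨rfl, rfl⟩ := h
      simp only [setPred_pred, mapAssignment]
    · simp only [setPred_pred_of_ne _ _ h, mapAssignment]
  exact congrArg (Assignment.mk _) (funext fun l => funext fun j => hp l j)

/-- An automorphism permutes the individuals and each domain of predicates, so quantifiers are
merely reindexed. -/
theorem eval_mapAssignment (he : M.IsAutomorphism e) (H : Formula) (f : Assignment M) :
    M.Eval H (he.mapAssignment f) ↔ M.Eval H f := by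
  induction H generalizing f with
  | app k i v => simp [Eval, mapAssignment, predEquiv, mapPred]
  | eqInd i j => exact e.injective.eq_iff
  | eqPred k i j => exact (he.predEquiv k).injective.eq_iff
  | not H ih => exact not_congr (ih f)
  | and H₁ H₂ ih₁ ih₂ => exact and_congr (ih₁ f) (ih₂ f)
  | or H₁ H₂ ih₁ ih₂ => exact or_congr (ih₁ f) (ih₂ f)
  | imp H₁ H₂ ih₁ ih₂ => exact imp_congr (ih₁ f) (ih₂ f)
  | iff H₁ H₂ ih₁ ih₂ => exact iff_congr (ih₁ f) (ih₂ f)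
  | allInd i H ih =>
    exact (e.forall_congr fun ξ => by rw [← mapAssignment_setInd, ih]).symm
  | exInd i H ih =>
    exact (e.exists_congr fun ξ => by rw [← mapAssignment_setInd, ih]).symm
  | allPred k i H ih =>
    exact ((he.predEquiv k).forall_congr fun α => by rw [← mapAssignment_setPred, ih]).symm
  | exPred k i H ih =>
    exact ((he.predEquiv k).exists_congr fun α => by rw [← mapAssignment_setPred, ih]).symm

end IsAutomorphism

/-! ### The structure of finitely supported predicates on `ℕ × A` -/

/-- The action of a permutation of `A` on the second coordinate of `ℕ × A`. -/
def columnPerm {A : Type u} (g : Equiv.Perm A) : Equiv.Perm (ℕ × A) :=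
  Equiv.prodCongr (Equiv.refl ℕ) g

/-- The predicate `P` on `ℕ × A` is invariant under all permutations of `A` that fix all elements
of `E`. -/
def Supports {A : Type u} {k : ℕ} (E : Set A) (P : (Fin (k + 1) → ℕ × A) → Prop) : Prop :=
  ∀ g : Equiv.Perm A, (∀ a ∈ E, g a = a) → ∀ w, P (fun t => columnPerm g (w t)) ↔ P w

/-- The structure of all predicates on `ℕ × A` with a finite support in `A`. -/
abbrev symmetric (A : Type u) [Nonempty A] : PredStructure.{u} where
  Ind := ℕ × A
  ind_nonempty := inferInstance
  J _ := {P | ∃ E : Set A, E.Finite ∧ Supports E P}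
  J_nonempty _ := ⟨fun _ => True, ∅, Set.finite_empty, fun _ _ _ => Iff.rfl⟩

section symmetric

variable {A : Type u}

/-- If `g'` fixes `g '' E` pointwise, then its conjugate `g⁻¹ * g' * g` fixes `E` pointwise. -/
theorem Supports.mapPred {k : ℕ} {E : Set A} {P : (Fin (k + 1) → ℕ × A) → Prop}
    (h : Supports E P) (g : Equiv.Perm A) :
    Supports (g '' E) (mapPred (columnPerm g) P) := by
  intro g' hg' w
  have := h (g⁻¹ * g' * g) (fun a ha => by simp [hg' (g a) ⟨a, ha, rfl⟩])
    (fun t => (columnPerm g).symm (w t))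
  have hcomp (p : ℕ × A) : columnPerm (g⁻¹ * g' * g) ((columnPerm g).symm p) =
      (columnPerm g).symm (columnPerm g' p) :=
    Prod.ext rfl (by simp [columnPerm])
  simp only [hcomp] at this
  exact this

theorem Supports.mapPred_eq {k : ℕ} {E : Set A} {P : (Fin (k + 1) → ℕ × A) → Prop}
    (h : Supports E P) {g : Equiv.Perm A} (hg : ∀ a ∈ E, g a = a) :
    PredStructure.mapPred (columnPerm g) P = P := by
  ext w
  simpa [PredStructure.mapPred] using (h g hg fun t => (columnPerm g).symm (w t)).symm

/-- A unary predicate on `ℕ × A` that is the graph of an injective partial function from `ℕ` to `A`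
defined on all numbers below `n`. -/
def IsInjectionBelow (n : ℕ) (D : ℕ × A → Prop) : Prop :=
  (∀ m < n, ∃ a, D (m, a)) ∧ ∀ p q, D p → D q → p.1 = q.1 ∨ p.2 = q.2 → p = q

theorem IsInjectionBelow.le_card {n : ℕ} {D : ℕ × A → Prop} (h : IsInjectionBelow n D)
    (E : Finset A) (hE : ∀ p, D p → p.2 ∈ E) : n ≤ E.card := by
  choose a ha using fun m : Fin n => h.1 m m.2
  have inj : Function.Injective a := fun m m' hmm' =>
    Fin.ext (congrArg Prod.fst (h.2 _ _ (ha m) (ha m') (.inr hmm')))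
  simpa using Finset.card_le_card_of_injOn (s := Finset.univ) (t := E) a
    (fun m _ => hE _ (ha m)) inj.injOn

variable [Nonempty A]

theorem isAutomorphism_columnPerm (g : Equiv.Perm A) :
    (symmetric A).IsAutomorphism (columnPerm g) where
  map_mem := fun ⟨E, hE, hP⟩ => ⟨g '' E, hE.image g, hP.mapPred g⟩
  map_symm_mem := fun ⟨E, hE, hP⟩ => ⟨g.symm '' E, hE.image g.symm, hP.mapPred g.symm⟩

theorem symmetric_isHenkin : (symmetric A).IsHenkin := by
  refine isHenkin_of_definable fun H f k v hv => ?_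
  choose E hE hs using fun k i => (f.pred k i).2
  refine ⟨((fun i => (f.ind i).2) '' {i | OccursInd i H}) ∪
    ⋃ p ∈ {p : ℕ × ℕ | OccursPred p.1 p.2 H}, E p.1 p.2,
    (H.finite_occursInd.image _).union (H.finite_occursPred.biUnion fun p _ => hE _ _),
    fun g hg w => ?_⟩
  -- On the variables of `H`, moving `w` by `g` has the same effect as moving the whole assignment,
  -- since `g` fixes every parameter.
  refine Iff.trans ?_ <| (isAutomorphism_columnPerm g).eval_mapAssignment H
    ⟨Function.extend v w f.ind, f.pred⟩
  refine eval_congr H ⟨fun i hi => ?_, fun l i hi => ?_⟩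
  · by_cases h : ∃ t, v t = i
    · obtain ⟨t, rfl⟩ := h
      simp [IsAutomorphism.mapAssignment, hv.extend_apply]
    · simp only [IsAutomorphism.mapAssignment, Function.extend_apply' _ _ _ h]
      exact Prod.ext rfl (hg _ (.inl ⟨i, hi, rfl⟩)).symm
  · refine Subtype.ext ((hs l i).mapPred_eq fun a ha => hg a (.inr ?_)).symm
    exact Set.mem_biUnion (x := (l, i)) hi ha

theorem symmetric_models_AC11 [Infinite A] : (symmetric A).Models {AC11} := by
  classical
  rintro _ rfl
  refine eval_AC11_of_uniformization ?_
  rintro R ⟨E, hE, hR⟩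
  -- Two fresh columns are needed: one of them may be the column of `x`, and the other then still
  -- serves as a target for the swap.
  obtain ⟨b, hb⟩ := hE.exists_notMem
  obtain ⟨c, hc⟩ := (hE.insert b).exists_notMem
  rw [Set.mem_insert_iff, not_or] at hc
  let E' : Set A := insert c (insert b E)
  /- An individual in a column of `E'` or in the column of `x`, in terms invariant under the
  permutations that fix `E'`. -/
  let decode (x : ℕ × A) (q : ℕ × Option E') : ℕ × A := (q.1, q.2.elim x.2 Subtype.val)
  let code (x : ℕ × A) : ℕ × Option E' :=
    Classical.epsilon fun q => R ![x, decode x q]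
  have hdecode (g : Equiv.Perm A) (hg : ∀ a ∈ E', g a = a) (x : ℕ × A) (q : ℕ × Option E') :
      decode (columnPerm g x) q = columnPerm g (decode x q) := by
    obtain ⟨m, _ | a⟩ := q
    · rfl
    · exact Prod.ext rfl (hg a.1 a.2).symm
  have hcode (g : Equiv.Perm A) (hg : ∀ a ∈ E', g a = a) (x : ℕ × A) :
      code (columnPerm g x) = code x := by
    -- `epsilon` depends only on the set of admissible codes, which is the same for `x` and its
    -- image.
    refine congrArg Classical.epsilon (funext fun q => propext ?_)
    have := hR g (fun a ha => hg a (.inr (.inr ha))) ![x, decode x q]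
    rw [comp_vec_two] at this
    rw [hdecode g hg]
    exact this
  have hex (x : ℕ × A) (hx : ∃ y, R ![x, y]) : R ![x, decode x (code x)] := by
    refine Classical.epsilon_spec (p := fun q => R ![x, decode x q]) ?_
    obtain ⟨y, hy⟩ := hx
    by_cases hyE : y.2 ∈ E'
    · exact ⟨(y.1, some ⟨y.2, hyE⟩), hy⟩
    by_cases hyx : y.2 = x.2
    · refine ⟨(y.1, none), ?_⟩
      change R ![x, (y.1, x.2)]
      rwa [← hyx]
    obtain ⟨e, heE', heE, hex⟩ : ∃ e ∈ E', e ∉ E ∧ x.2 ≠ e := by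
      by_cases hxb : x.2 = b
      · exact ⟨c, .inl rfl, hc.2, fun h => hc.1 (h.symm.trans hxb)⟩
      · exact ⟨b, .inr (.inl rfl), hb, hxb⟩
    -- Swapping the column of `y` with `e` fixes `x` and `E`, so it carries the witness `y` to a
    -- coded one.
    refine ⟨(y.1, some ⟨e, heE'⟩), ?_⟩
    have := hR (Equiv.swap y.2 e) (fun a ha => Equiv.swap_apply_of_ne_of_ne
      (by rintro rfl; exact hyE (.inr (.inr ha))) (by rintro rfl; exact heE ha)) ![x, y]
    rw [comp_vec_two] at this
    simp only [Matrix.cons_val_zero, Matrix.cons_val_one] at this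
    have hx' : columnPerm (Equiv.swap y.2 e) x = x :=
      Prod.ext rfl (Equiv.swap_apply_of_ne_of_ne (Ne.symm hyx) hex)
    have hy' : columnPerm (Equiv.swap y.2 e) y = (y.1, e) :=
      Prod.ext rfl (Equiv.swap_apply_left _ _)
    rw [hx', hy'] at this
    exact this.2 hy
  refine ⟨fun w => w 1 = decode (w 0) (code (w 0)), ⟨E', (hE.insert b).insert c, ?_⟩, ?_⟩
  · intro g hg w
    change columnPerm g (w 1) = decode (columnPerm g (w 0)) (code (columnPerm g (w 0))) ↔
      w 1 = decode (w 0) (code (w 0))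
    rw [hcode g hg, hdecode g hg, (columnPerm g).injective.eq_iff]
  · exact fun x hx => ⟨⟨_, hex x hx, rfl⟩, fun y z hy hz => hy.trans hz.symm⟩

/-- With `x_0` for `x` and the unary `D`, and with the binary parameters `<` (`A_0`), `~` (`A_1`)
and `≈` (`A_2`), the formula
`∀ u (u < x → ∃ v (D v ∧ u ~ v)) ∧ ∀ u ∀ v (D u ∧ D v ∧ (u ~ v ∨ u ≈ v) → u = v)`. -/
def injectionFormula : Formula :=
  Formula.and
    (allInd 1 (imp (app 1 0 ![1, 0]) (exInd 2 (Formula.and (app 0 0 ![2]) (app 1 1 ![1, 2])))))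
    (allInd 1 (allInd 2 (imp
      (Formula.and (app 0 0 ![1]) (Formula.and (app 0 0 ![2])
        (Formula.or (app 1 1 ![1, 2]) (app 1 2 ![1, 2]))))
      (eqInd 1 2))))

theorem choiceFormula_injectionFormula_mem :
    choiceFormula 0 3 0 3 injectionFormula ∈ choiceH11 := by
  refine ⟨0, 3, 0, 3, injectionFormula, ?_, ?_, ?_, by norm_num, ?_, ?_, rfl⟩ <;>
    simp [L2, injectionFormula, WellFormed, BoundInd, BoundPred, OccursInd, OccursPred]

/-- The assignment interpreting the parameters of `injectionFormula` by the comparison of first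
coordinates, their equality, and the equality of second coordinates. -/
noncomputable def coordinateAssignment (A : Type u) [Nonempty A] : Assignment (symmetric A) where
  ind _ := Classical.choice (symmetric A).ind_nonempty
  pred
    | 1, 0 => ⟨fun w => (w 0).1 < (w 1).1, ∅, Set.finite_empty, fun _ _ _ => Iff.rfl⟩
    | 1, 1 => ⟨fun w => (w 0).1 = (w 1).1, ∅, Set.finite_empty, fun _ _ _ => Iff.rfl⟩
    | 1, 2 => ⟨fun w => (w 0).2 = (w 1).2, ∅, Set.finite_empty,
        fun g _ _ => g.injective.eq_iff⟩
    | _, _ => ⟨fun _ => True, ∅, Set.finite_empty, fun _ _ _ => Iff.rfl⟩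

/-- Only the three parameters are constrained, so this applies both before and after `S`, with index
3, is assigned. -/
theorem eval_injectionFormula (f : Assignment (symmetric A))
    (hf : ∀ i < 3, f.pred 1 i = (coordinateAssignment A).pred 1 i) :
    (symmetric A).Eval injectionFormula f ↔
      IsInjectionBelow (f.ind 0).1 fun p => (f.pred 0 0).1 fun _ => p := by
  simp only [injectionFormula, Eval, setInd, hf 0 (by norm_num), hf 1 (by norm_num),
    hf 2 (by norm_num), coordinateAssignment, IsInjectionBelow]
  simp

theorem symmetric_not_models_choiceH11 [Infinite A] : ¬ (symmetric A).Models choiceH11 := by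
  classical
  intro h
  have hex : (symmetric A).Eval (allInd 0 (exPred 0 0 injectionFormula))
      (coordinateAssignment A) := by
    rintro ⟨n, a⟩
    let e := Infinite.natEmbedding A
    refine ⟨⟨fun w => (w 0).1 < n ∧ (w 0).2 = e (w 0).1, e '' Set.Iio n,
      (Set.finite_Iio n).image e, ?_⟩, ?_⟩
    · intro g hg w
      refine and_congr_right fun hlt => ?_
      change g (w 0).2 = e (w 0).1 ↔ _
      have hge : g (e (w 0).1) = e (w 0).1 := hg _ ⟨_, hlt, rfl⟩
      exact ⟨fun h => g.injective (h.trans hge.symm), fun h => (congrArg g h).trans hge⟩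
    · rw [eval_injectionFormula _ fun i _ => by simp [setPred, setInd]]
      simp only [setPred_pred]
      refine ⟨fun m hm => ⟨e m, hm, rfl⟩, ?_⟩
      rintro ⟨m, b⟩ ⟨m', c⟩ ⟨-, hb⟩ ⟨-, hc⟩ h
      change b = e m at hb
      change c = e m' at hc
      subst hb hc
      obtain rfl : m = m' := h.elim id fun h => e.injective h
      rfl
  obtain ⟨⟨S, E, hE, hSE⟩, hS⟩ := h _ choiceFormula_injectionFormula_mem (coordinateAssignment A) hex
  obtain ⟨a⟩ := ‹Nonempty A›
  -- The section of `S` at `(n, a)` is supported by `E ∪ {a}`; its values will be shown to lie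
  -- there, which leaves too few for an injection below `n`.
  let n := (insert a hE.toFinset).card + 1
  obtain ⟨D, hD, hH⟩ := hS (n, a)
  have hD' (p : ℕ × A) : D.1 (fun _ => p) ↔ S ![(n, a), p] := by
    have := hD p
    simp only [Eval, setInd, setPred, comp_vec_two] at this
    simpa using this
  rw [eval_injectionFormula _ fun i hi => by
    simp only [setPred, setInd]
    simp [hi.ne]] at hH
  simp only [setPred_pred, hD'] at hH
  replace hH : IsInjectionBelow n fun p => S ![(n, a), p] := hH
  refine (hH.le_card (insert a hE.toFinset) fun p hp => ?_).not_gt (Nat.lt_succ_self _)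
  by_contra hpE
  rw [Finset.mem_insert, hE.mem_toFinset, not_or] at hpE
  obtain ⟨b, hb⟩ := ((hE.insert a).insert p.2).exists_notMem
  simp only [Set.mem_insert_iff, not_or] at hb
  -- A value outside `E ∪ {a}` could be swapped with the fresh `b`, giving `p.1` two values.
  have := hSE (Equiv.swap p.2 b) (fun c hc => Equiv.swap_apply_of_ne_of_ne
    (by rintro rfl; exact hpE.2 hc) (by rintro rfl; exact hb.2.2 hc)) ![(n, a), p]
  have hx : columnPerm (Equiv.swap p.2 b) (n, a) = (n, a) :=
    Prod.ext rfl (Equiv.swap_apply_of_ne_of_ne (Ne.symm hpE.1) (Ne.symm hb.2.1))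
  have hy : columnPerm (Equiv.swap p.2 b) p = (p.1, b) :=
    Prod.ext rfl (Equiv.swap_apply_left _ _)
  rw [comp_vec_two] at this
  simp only [Matrix.cons_val_zero, Matrix.cons_val_one] at this
  rw [hx, hy] at this
  exact hb.1 (congrArg Prod.snd (hH.2 _ _ hp (this.2 hp) (.inl rfl))).symm

end symmetric

end PredStructure

end HPL

theorem theorem5 :
    HPL.Independent.{u} HPL.choiceH11 {HPL.AC11} ∧
      ¬ HPL.Entails.{u} {HPL.AC11} HPL.choiceH11 := by
  have hM : (HPL.PredStructure.symmetric (ULift.{u} ℕ)).IsHenkin :=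
    HPL.PredStructure.symmetric_isHenkin
  exact ⟨⟨⟨HPL.PredStructure.full (ULift.{u} ℕ), HPL.PredStructure.full_isHenkin _,
      HPL.PredStructure.full_models_AC11 _, HPL.PredStructure.full_models_choiceH11 _⟩,
    ⟨_, hM, HPL.PredStructure.symmetric_models_AC11,
      HPL.PredStructure.symmetric_not_models_choiceH11⟩⟩,
    fun h => HPL.PredStructure.symmetric_not_models_choiceH11
      (h _ hM HPL.PredStructure.symmetric_models_AC11)⟩
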